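/- Work in an arbitrary nonstandard extension ${}^{*}$ of the standard universe satisfying the transfer principle. Hyperreals $r,s$ satisfy $r\approx s$ if $|r-s|<\varepsilon$ for every standard $\varepsilon>0$, and for a metric space $(Y,d)$, points $x,y\in{}^{*}Y$ satisfy $x\approx y$ if ${}^{*}d(x,y)\approx 0$. **Theorem.** Let $Y$ be a compact metric space with its Borel $\sigma$-algebra $\mathcal B(Y)$, and let $\{A_i : 1\le i\le T\}$, $T\in{}^{*}\mathbb N$, be a hyperfinite (internal) partition of ${}^{*}Y$ into sets $A_i\in{}^{*}\mathcal B(Y)$, each of infinitesimal diameter. Let $P,Q$ be probability measures on $(Y,\mathcal B(Y))$ such that $Q$ dominates $P$, i.e. for every $\varepsilon>0$ there is $\delta>0$ with $P(C)<\varepsilon$ for all $C\in\mathcal B(Y)$ with $Q(C)<\delta$. Let $f:Y\to\mathbb R$ be a density function of $P$ with respect to $Q$, i.e. $f$ is Borel measurable and $Q$-integrable, and $P(C)=\int_C f\,dQ$ for all $C\in\mathcal B(Y)$. Suppose $f$ is continuous at $y_0\in Y$. Define the internal function $\varphi:{}^{*}Y\to{}^{*}\mathbb R$ by $$\varphi(x)=\sum_{i=1}^{T}\frac{{}^{*}P(A_i)}{{}^{*}Q(A_i)}\,\mathbf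 1_{A_i}(x),$$ where terms with ${}^{*}Q(A_i)=0$ are omitted. Then $\varphi(x)\approx{}^{*}f(y)$ for all $x,y\in{}^{*}Y$ such that $x\approx y\approx y_0$ and the cell $A_i$ containing $x$ satisfies ${}^{*}Q(A_i)\neq 0$. -/

import Mathlib

open MeasureTheory

universe u v w

/-- A nonstandard extension of the universe of types `Type u`: every type `α` has an extension
`*α`, every function `g : α → β` an extension `*g : *α → *β`, and every set (predicate, relation)
`A ⊆ α` an extension `*A ⊆ *α`, subject to the transfer principle.  Transfer is spelled out along
the construction of first-order formulas: terms (`map_id`, `map_comp`), tuples of variables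
(`unit_nonempty`, `unit_subsingleton`, `pair_bijective`), equality (`map_eq_map_iff`), atomic
formulas (`mem_set_preimage`), negation, conjunction, and existential quantification
(`set_image`).  By induction, a first-order statement is true of the standard objects if and only
if it is true of their extensions; as `Set α` and `α → β` are themselves types of the universe,
this includes statements quantifying over sets and functions, whose quantifiers then range over
the internal sets and functions, i.e. over `*(Set α)` and `*(α → β)`. -/
structure NonstandardExtension : Type (max (u + 1) (v + 1)) where
  /-- The extension `*α`. -/
  Star : Type u → Type v
  /-- The extension `*g`. -/
  map : ∀ {α β : Type u}, (α → β) → Star α → Star β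
  /-- The extension `*A`. -/
  set : ∀ {α : Type u}, Set α → Set (Star α)
  map_id : ∀ {α : Type u} (a : Star α), map (fun x : α => x) a = a
  map_comp : ∀ {α β γ : Type u} (h : β → γ) (g : α → β) (a : Star α),
    map (fun x => h (g x)) a = map h (map g a)
  unit_nonempty : Nonempty (Star PUnit.{u + 1})
  unit_subsingleton : Subsingleton (Star PUnit.{u + 1})
  pair_bijective : ∀ {α β : Type u},
    Function.Bijective (fun c : Star (α × β) => (map Prod.fst c, map Prod.snd c))
  map_eq_map_iff : ∀ {α β : Type u} (g h : α → β) (a : Star α),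
    map g a = map h a ↔ a ∈ set {x | g x = h x}
  mem_set_preimage : ∀ {α β : Type u} (g : α → β) (B : Set β) (a : Star α),
    a ∈ set {x | g x ∈ B} ↔ map g a ∈ set B
  set_compl : ∀ {α : Type u} (A : Set α), set Aᶜ = (set A)ᶜ
  set_inter : ∀ {α : Type u} (A B : Set α), set (A ∩ B) = set A ∩ set B
  set_image : ∀ {α β : Type u} (g : α → β) (A : Set α), set (g '' A) = map g '' set A

namespace NonstandardExtension

/-- The ultrapower of the universe by an arbitrary ultrafilter is a nonstandard extension. -/
noncomputable def ultrapower {I : Type w} (U : Ultrafilter I) :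
    NonstandardExtension.{u, max u w} where
  Star α := (U : Filter I).Germ α
  map g := Filter.Germ.map g
  set A := {a | Filter.Germ.LiftPred (fun x => x ∈ A) a}
  map_id a := by
    induction a using Filter.Germ.inductionOn with | _ a => rfl
  map_comp h g a := by
    induction a using Filter.Germ.inductionOn with | _ a => rfl
  unit_nonempty := ⟨((fun _ => PUnit.unit : I → PUnit.{u + 1}) : (U : Filter I).Germ PUnit)⟩
  unit_subsingleton := by
    refine ⟨fun a b => ?_⟩
    induction a, b using Filter.Germ.inductionOn₂ with | _ a b =>
    exact congrArg _ (Subsingleton.elim a b)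
  pair_bijective := by
    intro α β
    constructor
    · intro a b h
      induction a, b using Filter.Germ.inductionOn₂ with | _ a b =>
      have h1 := Filter.Germ.coe_eq.1 (congrArg Prod.fst h)
      have h2 := Filter.Germ.coe_eq.1 (congrArg Prod.snd h)
      refine Filter.Germ.coe_eq.2 ?_
      filter_upwards [h1, h2] with i hi1 hi2 using Prod.ext hi1 hi2
    · rintro ⟨a, b⟩
      induction a, b using Filter.Germ.inductionOn₂ with | _ a b =>
      exact ⟨((fun i => (a i, b i) : I → _) : (U : Filter I).Germ _), rfl⟩
  map_eq_map_iff g h a := by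
    induction a using Filter.Germ.inductionOn with | _ a => exact Filter.Germ.coe_eq
  mem_set_preimage g B a := by
    induction a using Filter.Germ.inductionOn with | _ a => exact Iff.rfl
  set_compl A := by
    ext a
    induction a using Filter.Germ.inductionOn with | _ a =>
    exact Ultrafilter.eventually_not
  set_inter A B := by
    ext a
    induction a using Filter.Germ.inductionOn with | _ a =>
    exact Filter.eventually_and
  set_image {α β} g A := by
    ext b
    constructor
    · induction b using Filter.Germ.inductionOn with | _ b =>
      intro hb
      have hb' : ∀ᶠ i in (U : Filter I), ∃ x, x ∈ A ∧ g x = b i := hb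
      obtain ⟨i₀, x₀, -, -⟩ := hb'.exists
      have : ∀ i, ∃ x, (∃ x, x ∈ A ∧ g x = b i) → x ∈ A ∧ g x = b i := fun i => by
        by_cases h : ∃ x, x ∈ A ∧ g x = b i
        · exact ⟨h.choose, fun _ => h.choose_spec⟩
        · exact ⟨x₀, fun h' => absurd h' h⟩
      choose a ha using this
      have h1 : ∀ᶠ i in (U : Filter I), a i ∈ A := hb'.mono fun i hi => (ha i hi).1
      have h2 : ∀ᶠ i in (U : Filter I), g (a i) = b i := hb'.mono fun i hi => (ha i hi).2
      have h3 : ((fun i => g (a i) : I → β) : (U : Filter I).Germ β) = b :=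
        Filter.Germ.coe_eq.2 h2
      exact ⟨(a : (U : Filter I).Germ α), h1, h3⟩
    · rintro ⟨a, ha, hab⟩
      subst hab
      revert ha
      induction a using Filter.Germ.inductionOn with | _ a =>
      intro ha
      exact Filter.Eventually.mono ha fun i hi => ⟨a i, hi, rfl⟩

variable (E : NonstandardExtension.{u, v})

/-- The pair `(a, b)` as an element of `*(α × β)`. -/
noncomputable def pair {α β : Type u} (a : E.Star α) (b : E.Star β) : E.Star (α × β) :=
  (Equiv.ofBijective _ E.pair_bijective).symm (a, b)

/-- The value `*g(a, b)` of the extension of a function of two variables. -/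
noncomputable def map₂ {α β γ : Type u} (g : α → β → γ) (a : E.Star α) (b : E.Star β) :
    E.Star γ :=
  E.map (fun c : α × β => g c.1 c.2) (E.pair a b)

/-- The extension `*R` of a binary relation. -/
def Rel {α β : Type u} (R : α → β → Prop) (a : E.Star α) (b : E.Star β) : Prop :=
  E.pair a b ∈ E.set {c : α × β | R c.1 c.2}

/-- The standard element `*a` of `*α`. -/
noncomputable def std {α : Type u} (a : α) : E.Star α :=
  E.map (fun _ : PUnit.{u + 1} => a) E.unit_nonempty.some

/-- The hyperreals `*ℝ`. -/
abbrev HyperReal : Type v := E.Star (ULift.{u} ℝ)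

/-- The hypernaturals `*ℕ`. -/
abbrev HyperNat : Type v := E.Star (ULift.{u} ℕ)

/-- `r ≈ s` in `*ℝ`: `|r - s| < ε` for every standard `ε > 0`. -/
def Approx (r s : E.HyperReal) : Prop :=
  ∀ ε : ℝ, 0 < ε → E.Rel (fun a b : ULift.{u} ℝ => |a.down - b.down| < ε) r s

/-- The zero of `*ℝ`. -/
noncomputable def zero : E.HyperReal := E.std (ULift.up (0 : ℝ))

/-- `x ≈ y` in `*Y`, for a metric space `Y`: `*d(x, y) ≈ 0`. -/
def Near {Y : Type u} [MetricSpace Y] (x y : E.Star Y) : Prop :=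
  E.Approx (E.map₂ (fun a b => ULift.up (dist a b)) x y) E.zero

/-- The extension `*f : *Y → *ℝ` of a real function. -/
noncomputable def mapReal {Y : Type u} (f : Y → ℝ) (y : E.Star Y) : E.HyperReal :=
  E.map (fun a => ULift.up (f a)) y

/-- `x ∈ A` for an internal set `A`. -/
def Mem {Y : Type u} (x : E.Star Y) (A : E.Star (Set Y)) : Prop :=
  E.Rel (fun a B => a ∈ B) x A

/-- `*P(A)` for an internal set `A`. -/
noncomputable def hyperMeasure {Y : Type u} [MeasurableSpace Y] (P : Measure Y) (A : E.Star (Set Y)) :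
    E.HyperReal :=
  E.map (fun B => ULift.up (P.real B)) A

/-- The diameter of an internal set. -/
noncomputable def diam {Y : Type u} [MetricSpace Y] (A : E.Star (Set Y)) : E.HyperReal :=
  E.map (fun B => ULift.up (Metric.diam B)) A

/-- The term `a i` of an internal sequence `a` at a hypernatural `i`. -/
noncomputable def term {α : Type u} (a : E.Star (ULift.{u} ℕ → α)) (i : E.HyperNat) : E.Star α :=
  E.map₂ (fun b j => b j) a i

/-- `1 ≤ i ≤ T` in `*ℕ`. -/
def IsIndex (T i : E.HyperNat) : Prop :=
  E.Rel (fun t j : ULift.{u} ℕ => 1 ≤ j.down ∧ j.down ≤ t.down) T i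

/-- The hyperfinite sum `∑_{i = 1}^{T} a i` of an internal sequence of hyperreals. -/
noncomputable def hyperSum (T : E.HyperNat) (a : E.Star (ULift.{u} ℕ → ULift.{u} ℝ)) :
    E.HyperReal :=
  E.map₂ (fun t b => ULift.up (∑ i ∈ Finset.Icc 1 t.down, (b (ULift.up i)).down)) T a

/-- The internal sequence `A` restricted to `1 ≤ i ≤ T` is a hyperfinite partition of `*Y` into
*Borel sets of infinitesimal diameter. -/
structure IsInfinitesimalPartition {Y : Type u} [MetricSpace Y] [MeasurableSpace Y]
    (T : E.HyperNat) (A : E.Star (ULift.{u} ℕ → Set Y)) : Prop where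
  borel : ∀ i, E.IsIndex T i → E.term A i ∈ E.set {B : Set Y | MeasurableSet B}
  disjoint : ∀ i j, E.IsIndex T i → E.IsIndex T j → i ≠ j →
    ∀ x, ¬ (E.Mem x (E.term A i) ∧ E.Mem x (E.term A j))
  cover : ∀ x, ∃ i, E.IsIndex T i ∧ E.Mem x (E.term A i)
  diam_infinitesimal : ∀ i, E.IsIndex T i → E.Approx (E.diam (E.term A i)) E.zero

/-- The internal function `φ(x) = ∑_{i = 1}^{T} (*P(A_i) / *Q(A_i)) · 1_{A_i}(x)`, in which a term
with `*Q(A_i) = 0` counts as `0`. -/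
noncomputable def ratio {Y : Type u} [MeasurableSpace Y] (P Q : Measure Y) (T : E.HyperNat)
    (A : E.Star (ULift.{u} ℕ → Set Y)) (x : E.Star Y) : E.HyperReal :=
  E.hyperSum T (E.map₂
    (fun (B : ULift.{u} ℕ → Set Y) (z : Y) (i : ULift.{u} ℕ) =>
      ULift.up (P.real (B i) / Q.real (B i) * (B i).indicator (fun _ => (1 : ℝ)) z)) A x)

end NonstandardExtension

/-- `Q` dominates `P`. -/
def Dominates {Y : Type u} [MeasurableSpace Y] (Q P : Measure Y) : Prop :=
  ∀ ε : ℝ, 0 < ε → ∃ δ : ℝ, 0 < δ ∧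
    ∀ C : Set Y, MeasurableSet C → Q.real C < δ → P.real C < ε

/-- `f` is a density function of `P` with respect to `Q`. -/
structure IsDensity {Y : Type u} [MeasurableSpace Y] (f : Y → ℝ) (P Q : Measure Y) : Prop where
  measurable : Measurable f
  integrable : Integrable f Q
  measure_eq : ∀ C : Set Y, MeasurableSet C → P.real C = ∫ x in C, f x ∂Q

/-!
The internal data `T`, `A`, `x`, `y`, together with the index `i` of the cell containing `x`, are
the coordinates of a single point `c` of the extension of a product type. A first-order property of
these data then says that `c` lies in the extension `*S` of a standard set `S`, and transfer becomes
monotonicity of `S ↦ *S` (`NonstandardExtension.set_mono`). The disjointness of the cells, whose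
quantifier ranges over internal indices, is brought into this form by
`NonstandardExtension.mem_set_forall`.

It remains to argue about standard objects. Disjointness collapses the sum defining `φ(x)` to the
single term `P(B) / Q(B)`, where `B` is the cell containing `x`. If `B` has small diameter and meets
a small neighbourhood of `y₀`, then by continuity `f` is within `ε` of `f y₀` on all of `B`, and so is
its mean `P(B) / Q(B) = Q(B)⁻¹ ∫_B f dQ` (`IsDensity.abs_ratio_sub_le`). The value `f y` is likewise
within `ε` of `f y₀`.
-/

namespace NonstandardExtension

variable (E : NonstandardExtension.{u, v})

theorem set_mono {α : Type u} {S S' : Set α} (h : S ⊆ S') : E.set S ⊆ E.set S' := by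
  rw [← Set.inter_eq_left, ← E.set_inter, Set.inter_eq_left.2 h]

theorem pair_map {α β γ : Type u} (g : γ → α) (h : γ → β) (c : E.Star γ) :
    E.pair (E.map g c) (E.map h c) = E.map (fun z => (g z, h z)) c := by
  rw [pair, Equiv.symm_apply_eq]
  exact Prod.ext (E.map_comp Prod.fst (fun z => (g z, h z)) c)
    (E.map_comp Prod.snd (fun z => (g z, h z)) c)

theorem map_fst_pair {α β : Type u} (a : E.Star α) (b : E.Star β) :
    E.map Prod.fst (E.pair a b) = a :=
  congrArg Prod.fst ((Equiv.ofBijective _ E.pair_bijective).apply_symm_apply (a, b))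

theorem map_snd_pair {α β : Type u} (a : E.Star α) (b : E.Star β) :
    E.map Prod.snd (E.pair a b) = b :=
  congrArg Prod.snd ((Equiv.ofBijective _ E.pair_bijective).apply_symm_apply (a, b))

theorem map₂_map {α β γ δ : Type u} (k : α → β → δ) (g : γ → α) (h : γ → β) (c : E.Star γ) :
    E.map₂ k (E.map g c) (E.map h c) = E.map (fun z => k (g z) (h z)) c := by
  rw [map₂, pair_map, ← E.map_comp]

theorem rel_map {α β γ : Type u} (R : α → β → Prop) (g : γ → α) (h : γ → β) (c : E.Star γ) :
    E.Rel R (E.map g c) (E.map h c) ↔ c ∈ E.set {z | R (g z) (h z)} := by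
  rw [Rel, pair_map, ← E.mem_set_preimage]
  rfl

theorem std_eq_map {α γ : Type u} (a : α) (c : E.Star γ) : E.std a = E.map (fun _ => a) c := by
  have := E.unit_subsingleton
  rw [std, Subsingleton.elim E.unit_nonempty.some (E.map (fun _ => PUnit.unit) c), ← E.map_comp]

theorem approx_map {γ : Type u} (g h : γ → ULift.{u} ℝ) (c : E.Star γ) :
    E.Approx (E.map g c) (E.map h c) ↔
      ∀ ε : ℝ, 0 < ε → c ∈ E.set {z | |(g z).down - (h z).down| < ε} := by
  simp only [Approx, rel_map]

theorem near_map {Y γ : Type u} [MetricSpace Y] (g h : γ → Y) (c : E.Star γ) :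
    E.Near (E.map g c) (E.map h c) ↔
      ∀ ε : ℝ, 0 < ε → c ∈ E.set {z | dist (g z) (h z) < ε} := by
  simp only [Near, map₂_map, zero, E.std_eq_map _ c, approx_map, sub_zero, abs_dist]

/-- Transfer of a universal quantifier: a property holding at all internal points over `c` holds
as a quantified statement at `c`. -/
theorem mem_set_forall {α β : Type u} (p : α → β → Prop) (c : E.Star α)
    (h : ∀ d : E.Star (α × β), E.map Prod.fst d = c → d ∈ E.set {q | p q.1 q.2}) :
    c ∈ E.set {z | ∀ w, p z w} := by
  by_contra hc
  have hS : {z | ∀ w, p z w}ᶜ = Prod.fst '' {q : α × β | p q.1 q.2}ᶜ := by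
    ext z
    simp
  rw [← Set.mem_compl_iff, ← E.set_compl, hS, E.set_image] at hc
  obtain ⟨d, hd, hdc⟩ := hc
  rw [E.set_compl] at hd
  exact hd (h d hdc)

end NonstandardExtension

/-- If `f` is within `ε` of `r` on a set of positive measure, so is its mean there. -/
theorem IsDensity.abs_ratio_sub_le {Y : Type u} [MeasurableSpace Y] {f : Y → ℝ} {P Q : Measure Y}
    [IsFiniteMeasure Q] (hf : IsDensity f P Q) {B : Set Y} (hB : MeasurableSet B)
    (hQB : Q.real B ≠ 0) {r ε : ℝ} (h : ∀ z ∈ B, |f z - r| ≤ ε) :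
    |P.real B / Q.real B - r| ≤ ε := by
  have hpos : 0 < Q.real B := lt_of_le_of_ne measureReal_nonneg (Ne.symm hQB)
  have h1 : P.real B - r * Q.real B = ∫ z in B, (f z - r) ∂Q := by
    rw [integral_sub hf.integrable.integrableOn (integrable_const r), hf.measure_eq B hB]
    simp [mul_comm]
  have h2 : ‖∫ z in B, (f z - r) ∂Q‖ ≤ ε * Q.real B :=
    norm_setIntegral_le_of_norm_le_const (measure_lt_top Q B) h
  rw [div_sub' hQB, abs_div, abs_of_pos hpos, div_le_iff₀ hpos, mul_comm (Q.real B) r, h1]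
  exact h2

theorem sum_mul_indicator_eq_of_unique {ι Y : Type*} {s : Finset ι} (a : ι → ℝ) {B : ι → Set Y}
    {i : ι} {z : Y} (hi : i ∈ s) (hz : z ∈ B i) (h : ∀ j ∈ s, j ≠ i → z ∉ B j) :
    ∑ j ∈ s, a j * (B j).indicator (fun _ => (1 : ℝ)) z = a i := by
  rw [Finset.sum_eq_single_of_mem i hi]
  · simp [hz]
  · intro j hj hji
    simp [h j hj hji]

theorem mainTheorem4 (E : NonstandardExtension.{u, v})
    {Y : Type u} [MetricSpace Y] [CompactSpace Y] [MeasurableSpace Y] [BorelSpace Y]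
    (T : E.HyperNat) (A : E.Star (ULift.{u} ℕ → Set Y)) (hA : E.IsInfinitesimalPartition T A)
    (P Q : Measure Y) [IsProbabilityMeasure P] [IsProbabilityMeasure Q] (hPQ : Dominates Q P)
    (f : Y → ℝ) (hf : IsDensity f P Q) (y₀ : Y) (hy₀ : ContinuousAt f y₀)
    (x y : E.Star Y) (hxy : E.Near x y) (hyy₀ : E.Near y (E.std y₀))
    (hQ : ∀ i, E.IsIndex T i → E.Mem x (E.term A i) → E.hyperMeasure Q (E.term A i) ≠ E.zero) :
    E.Approx (E.ratio P Q T A x) (E.mapReal f y) := by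
  obtain ⟨i, hi, hxi⟩ := hA.cover x
  have hQi := hQ i hi hxi
  have hBi := hA.borel i hi
  have hdi := hA.diam_infinitesimal i hi
  have hdisj := fun j hj hji hxj => hA.disjoint j i hj hi hji x ⟨hxj, hxi⟩
  clear hA hQ
  -- All internal data become functions of the single point `c`.
  obtain ⟨γ, c, t, B, p, q, k, rfl, rfl, rfl, rfl, rfl⟩ : ∃ (γ : Type u) (c : E.Star γ)
      (t : γ → ULift.{u} ℕ) (B : γ → ULift.{u} ℕ → Set Y) (p q : γ → Y) (k : γ → ULift.{u} ℕ),
      E.map t c = T ∧ E.map B c = A ∧ E.map p c = x ∧ E.map q c = y ∧ E.map k c = i := by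
    refine ⟨_, E.pair (E.pair T A) (E.pair (E.pair x y) i), fun z => z.1.1, fun z => z.1.2,
      fun z => z.2.1.1, fun z => z.2.1.2, fun z => z.2.2, ?_, ?_, ?_, ?_, ?_⟩
    · rw [E.map_comp Prod.fst Prod.fst, E.map_fst_pair, E.map_fst_pair]
    · rw [E.map_comp Prod.snd Prod.fst, E.map_fst_pair, E.map_snd_pair]
    · rw [E.map_comp (fun w : (Y × Y) × ULift.{u} ℕ => w.1.1) Prod.snd, E.map_snd_pair,
        E.map_comp Prod.fst Prod.fst, E.map_fst_pair, E.map_fst_pair]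
    · rw [E.map_comp (fun w : (Y × Y) × ULift.{u} ℕ => w.1.2) Prod.snd, E.map_snd_pair,
        E.map_comp Prod.snd Prod.fst, E.map_fst_pair, E.map_snd_pair]
    · rw [E.map_comp Prod.snd Prod.snd, E.map_snd_pair, E.map_snd_pair]
  -- The cells other than that of index `i` do not contain `x`, as a membership of `c`: a failure
  -- of it would yield, by transfer, an internal index contradicting `hdisj`.
  have huniq : c ∈ E.set {z | ∀ j : ULift.{u} ℕ,
      (1 ≤ j.down ∧ j.down ≤ (t z).down) → j ≠ k z → p z ∉ B z j} := by
    refine E.mem_set_forall _ c fun d hd => ?_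
    subst hd
    by_contra hcon
    rw [← Set.mem_compl_iff, ← E.set_compl] at hcon
    refine hdisj (E.map Prod.snd d) ?_ ?_ ?_
    · rw [NonstandardExtension.IsIndex, ← E.map_comp, E.rel_map]
      refine E.set_mono (fun a ha => ?_) hcon
      by_contra h
      exact ha fun h' => absurd h' h
    · rw [← E.map_comp, Ne, E.map_eq_map_iff, ← Set.mem_compl_iff, ← E.set_compl]
      refine E.set_mono (fun a ha h => ?_) hcon
      exact ha fun _ h' => absurd h h'
    · rw [NonstandardExtension.Mem, NonstandardExtension.term, ← E.map_comp, ← E.map_comp,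
        E.map₂_map, E.rel_map]
      refine E.set_mono (fun a ha => ?_) hcon
      by_contra h
      exact ha fun _ _ => h
  simp only [NonstandardExtension.IsIndex, NonstandardExtension.Mem, NonstandardExtension.term,
    NonstandardExtension.map₂_map, NonstandardExtension.rel_map] at hi hxi hBi hdi hQi
  rw [← E.mem_set_preimage] at hBi
  rw [NonstandardExtension.hyperMeasure, NonstandardExtension.zero, ← E.map_comp,
    E.std_eq_map _ c, Ne, E.map_eq_map_iff, ← Set.mem_compl_iff, ← E.set_compl] at hQi
  rw [NonstandardExtension.diam, NonstandardExtension.zero, ← E.map_comp, E.std_eq_map _ c,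
    E.approx_map] at hdi
  rw [E.std_eq_map _ c, E.near_map] at hyy₀
  rw [E.near_map] at hxy
  rw [NonstandardExtension.ratio, E.map₂_map, NonstandardExtension.hyperSum, E.map₂_map,
    NonstandardExtension.mapReal, ← E.map_comp, E.approx_map]
  intro ε hε
  obtain ⟨δ, hδ, hfδ⟩ := Metric.continuousAt_iff.1 hy₀ (ε / 2) (half_pos hε)
  have hδ3 : 0 < δ / 3 := by positivity
  have hc := Set.mem_inter hi <| Set.mem_inter hxi <| Set.mem_inter hBi <| Set.mem_inter hQi <|
    Set.mem_inter (hdi _ hδ3) <| Set.mem_inter (hxy _ hδ3) <| Set.mem_inter (hyy₀ _ hδ3) huniq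
  simp only [← E.set_inter] at hc
  refine E.set_mono ?_ hc
  rintro z ⟨⟨h1, hkt⟩, hpB, hmeas, hQB, hdiam, hpq, hqy, hu⟩
  simp only [Set.mem_ofPred_eq, Set.mem_compl_iff, ULift.up_inj, sub_zero]
    at hpB hmeas hQB hdiam hpq hqy hu ⊢
  have hsum := sum_mul_indicator_eq_of_unique
    (fun j => P.real (B z (ULift.up j)) / Q.real (B z (ULift.up j)))
    (B := fun j => B z (ULift.up j)) (Finset.mem_Icc.2 ⟨h1, hkt⟩) hpB
    fun j hj hjk => hu (ULift.up j) (Finset.mem_Icc.1 hj) fun h => hjk (congrArg ULift.down h)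
  have hball : ∀ w ∈ B z (k z), |f w - f y₀| ≤ ε / 2 := fun w hw => by
    -- Compactness bounds the cell, so that its diameter is not the junk value `0`.
    have hwp := (Metric.dist_le_diam_of_mem
      (isCompact_univ.isBounded.subset (Set.subset_univ _)) hw hpB).trans_lt (lt_of_abs_lt hdiam)
    have := dist_triangle4 w (p z) (q z) y₀
    exact (hfδ (by linarith)).le
  have hmean := hf.abs_ratio_sub_le hmeas hQB hball
  have hfy : |f (q z) - f y₀| < ε / 2 := hfδ (by linarith)
  rw [hsum]
  calc _ ≤ _ := abs_sub_le _ (f y₀) _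
    _ < ε / 2 + ε / 2 := add_lt_add_of_le_of_lt hmean (by rwa [abs_sub_comm])
    _ = ε := add_halves ε
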